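/- Proposition 4.1. Let $X=[0,1]$ and, for integers $b\ge 2$, let $\varphi_b:X\to X$, $\varphi_b(x)=1/(b-x)$. Then $\{\varphi_b\}_{b\ge 2}$ is a regular parabolic iterated function system. It has exactly one parabolic index, namely $b=2$, with neutral fixed point $x=1$ (that is, $\varphi_2(1)=1$ and $|\varphi_2'(1)|=1$). The Hausdorff dimension of its limit set is $1$. The notions are the following. Let $X$ be a compact connected subset of a Euclidean space and let $\varphi_i:X\to X$, $i\in I$, be maps, where $I$ is countable with at least two elements. For a finite word $\omega=\omega_1\cdots\omega_n$ put $\varphi_\omega=\varphi_{\omega_1}\circ\cdots\circ\varphi_{\omega_n}$ and $\|\varphi_\omega'\|=\sup_X|\varphi_\omega'|$. A pair $(i,x)$ with $x\in X$ is parabolic if $x$ is the unique fixed point of $\varphi_i$ in $X$ and $|\varphi_i'(x)|=1$; then $i$ is called a parabolic index, and all other indices are hyperbolic. A nonempty word $\omega$ is admissible if its last letter is hyperbolic, or if $n\ge 2$ and $\omega_{n-1}\ne\omega_n$. The system is a parabolic iterated function system if there is at least one parabolic index and: 1. $\varphi_i(\operatorname{Int}X)\cap\varphi_j(\operatorname{Int}X)=\emptyset$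 for $i\ne j$; 2. there are only finitely many parabolic pairs, and $|\varphi_i'(x)|<1$ whenever $x\in X$ and $(i,x)$ is not parabolic; 3. there are an open connected set $V\supseteq X$ and extensions of the maps $\varphi_i$, conformal on $V$, such that for every admissible $\omega$ the corresponding extension of $\varphi_\omega$ is conformal on $V$ and maps $V$ into itself (conformal means: $C^1$, injective, and with derivative at each point a nonzero multiple of a linear isometry); the conditions 5, 6 and 8 refer to $V$ and these extensions; 4. if $(i,x)$ is parabolic, then $\bigcap_{n\ge 0}\varphi_i^n(X)=\{x\}$ and $\operatorname{diam}\varphi_i^n(X)\to 0$; 5. there is $K\ge 1$ with $|\varphi_\omega'(y)|\le K|\varphi_\omega'(x)|$ for all admissible $\omega$ and all $x,y\in V$; 6. there is $s<1$ with $|\varphi_\omega'|\le s$ on $V$ for all admissible $\omega$; 7. there are an angle in $(0,\pi)$ and an altitude $l>0$ such that every $x\in\partial X$ is the vertex of an open cone with this opening angle and altitude that is contained in $\operatorname{Int}X$; 8. there are $L\ge 1$ and $\alpha>0$ with $\bigl||\varphi_i'(y)|-|\varphi_i'(x)|\bigr|\le L\|\varphi_i'\|\,|y-x|^\alpha$ for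 all $i\in I$ and $x,y\in V$. The topological pressure of a system is $P(t)=\lim_{n\to\infty}\frac1n\log\sum_{\omega\in I^n}\|\varphi_\omega'\|^t$. The associated system $S^*$ of a parabolic system $S$ consists of the maps $\varphi_k$ with $k$ hyperbolic and the maps $\varphi_{i^nj}$ with $n\ge 1$, $i$ parabolic and $j\ne i$. The system $S$ is regular if there is $t\ge 0$ at which the pressures of $S^*$ and of $S$ both exist and equal $0$. The limit set is $J=\pi(I^{\mathbb N})$, where $\{\pi(\omega)\}=\bigcap_{n\ge 0}\varphi_{\omega_1\cdots\omega_n}(X)$. -/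

import Mathlib

/-- The composition `φ_ω = φ_{ω₁} ∘ ⋯ ∘ φ_{ωₙ}` attached to a finite word `ω = [ω₁, …, ωₙ]`. -/
def wordMap {I E : Type*} (φ : I → E → E) : List I → E → E
  | [] => id
  | i :: w => φ i ∘ wordMap φ w

section Systems

variable {I E : Type*} [NormedAddCommGroup E] [InnerProductSpace ℝ E]

/-- `(i, x)` is a parabolic pair: `x` is the unique fixed point of `φ_i` in `X`, and it is neutral,
`|φ_i'(x)| = 1`. -/
def IsParabolicPair (X : Set E) (φ : I → E → E) (i : I) (x : E) : Prop :=
  x ∈ X ∧ φ i x = x ∧ (∀ y ∈ X, φ i y = y → y = x) ∧ ‖fderivWithin ℝ (φ i) X x‖ = 1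

/-- The set `Ω` of parabolic indices. All other indices are hyperbolic. -/
def parabolicIndices (X : Set E) (φ : I → E → E) : Set I :=
  {i | ∃ x, IsParabolicPair X φ i x}

/-- The nonempty finite words `ω₁ … ωₙ` such that `ωₙ` is not in `Ω`, or `n ≥ 2` and
`ωₙ₋₁ ≠ ωₙ`. -/
def IsAdmissibleWord (Ω : Set I) (w : List I) : Prop :=
  ∃ (v : List I) (j : I), (w = v ++ [j] ∧ j ∉ Ω) ∨ (∃ k, k ≠ j ∧ w = v ++ [k, j])

/-- `f` is a conformal diffeomorphism of the open set `U` onto its image: it is `C¹`, injective, and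
its derivative at each point of `U` is a nonzero multiple of a linear isometry. -/
def IsConformalOn (f : E → E) (U : Set E) : Prop :=
  ContDiffOn ℝ 1 f U ∧ Set.InjOn f U ∧ ∀ x ∈ U, ConformalAt f x

/-- The norm `‖f'‖ = sup_{x ∈ X} |f'(x)|`. -/
noncomputable def derivNorm (X : Set E) (f : E → E) : ENNReal :=
  ⨆ x ∈ X, ‖fderivWithin ℝ f X x‖ₑ

/-- The open cone with vertex `x`, axis direction `u` (a unit vector), half-angle `θ` and
altitude `l`. -/
def openCone (x u : E) (θ l : ℝ) : Set E :=
  {y | Real.cos θ * ‖y - x‖ < inner ℝ u (y - x) ∧ inner ℝ u (y - x) < l}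

/-- The maps `Φ i` extend the maps `φ i : X → X` conformally to the open connected set `V ⊇ X` in
such a way that the composites along admissible words are conformal maps of `V` into itself with
uniformly bounded distortion and uniform contraction, and the `|Φ_i'|` are Hölder on `V`. -/
structure IsConformalExtension (X : Set E) (φ : I → E → E) (V : Set E) (Φ : I → E → E) :
    Prop where
  isOpen : IsOpen V
  isConnected : IsConnected V
  subset : X ⊆ V
  eqOn : ∀ i, Set.EqOn (Φ i) (φ i) X
  conformal : ∀ i, IsConformalOn (Φ i) V
  word_conformal : ∀ w, IsAdmissibleWord (parabolicIndices X φ) w →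
    IsConformalOn (wordMap Φ w) V ∧ Set.MapsTo (wordMap Φ w) V V
  bounded_distortion : ∃ K : ℝ, 1 ≤ K ∧
    ∀ w, IsAdmissibleWord (parabolicIndices X φ) w → ∀ x ∈ V, ∀ y ∈ V,
      ‖fderiv ℝ (wordMap Φ w) y‖ ≤ K * ‖fderiv ℝ (wordMap Φ w) x‖
  contraction : ∃ s : ℝ, s < 1 ∧
    ∀ w, IsAdmissibleWord (parabolicIndices X φ) w → ∀ x ∈ V,
      ‖fderiv ℝ (wordMap Φ w) x‖ ≤ s
  holder : ∃ L α : ℝ, 1 ≤ L ∧ 0 < α ∧ ∀ i, ∀ x ∈ V, ∀ y ∈ V,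
    |‖fderiv ℝ (Φ i) y‖ - ‖fderiv ℝ (Φ i) x‖| ≤ L * (derivNorm X (φ i)).toReal * dist y x ^ α

/-- A (conformal) parabolic iterated function system `(φ i)_{i ∈ I}` on the subset `X` of a
Euclidean space. Only the values of the `φ i` on `X` matter. -/
structure IsParabolicIFS [FiniteDimensional ℝ E] (X : Set E) (φ : I → E → E) : Prop where
  countable : Countable I
  nontrivial : Nontrivial I
  isCompact : IsCompact X
  isConnected : IsConnected X
  mapsTo : ∀ i, Set.MapsTo (φ i) X X
  open_set_condition : ∀ i j, i ≠ j → Disjoint (φ i '' interior X) (φ j '' interior X)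
  finite_parabolic : {p : I × E | IsParabolicPair X φ p.1 p.2}.Finite
  deriv_lt_one : ∀ i, ∀ x ∈ X, ¬ IsParabolicPair X φ i x → ‖fderivWithin ℝ (φ i) X x‖ < 1
  extension : ∃ (V : Set E) (Φ : I → E → E), IsConformalExtension X φ V Φ
  parabolic_iterates : ∀ i x, IsParabolicPair X φ i x →
    (⋂ n : ℕ, (φ i)^[n] '' X) = {x} ∧
    Filter.Tendsto (fun n : ℕ => Metric.diam ((φ i)^[n] '' X)) Filter.atTop (nhds 0)
  cone_condition : ∃ θ l : ℝ, 0 < θ ∧ θ < Real.pi / 2 ∧ 0 < l ∧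
    ∀ x ∈ frontier X, ∃ u : E, ‖u‖ = 1 ∧ openCone x u θ l ⊆ interior X
  parabolic : (parabolicIndices X φ).Nonempty

/-- The limit set `J = π(I^∞)`, where `{π(ω)} = ⋂ₙ φ_{ω₁…ωₙ}(X)`. -/
def limitSet (X : Set E) (φ : I → E → E) : Set E :=
  {x | ∃ ω : ℕ → I, (⋂ n : ℕ, wordMap φ (List.ofFn fun k : Fin n => ω k) '' X) = {x}}

/-- The partition function `Zₙ(t) = ∑_{ω ∈ Iⁿ} ‖φ_ω'‖ᵗ`, with values in `[0, ∞]`. -/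
noncomputable def partitionFunction (X : Set E) (φ : I → E → E) (n : ℕ) (t : ℝ) : ENNReal :=
  ∑' ω : Fin n → I, derivNorm X (wordMap φ (List.ofFn ω)) ^ t

/-- The topological pressure `P(t) = limₙ (1/n) log Zₙ(t)` exists and is equal to `p`. -/
def HasPressure (X : Set E) (φ : I → E → E) (t : ℝ) (p : EReal) : Prop :=
  Filter.Tendsto (fun n : ℕ => ENNReal.log (partitionFunction X φ n t) / (n : EReal))
    Filter.atTop (nhds p)

/-- The alphabet of the associated hyperbolic system `S*`: the one-letter words `k` with `k`
hyperbolic and the words `iⁿj` with `n ≥ 1`, `i` parabolic and `j ≠ i`. -/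
def AssociatedIndex (X : Set E) (φ : I → E → E) : Type _ :=
  {w : List I // (∃ k, k ∉ parabolicIndices X φ ∧ w = [k]) ∨
    ∃ i ∈ parabolicIndices X φ, ∃ j, j ≠ i ∧ ∃ n : ℕ, 1 ≤ n ∧ w = List.replicate n i ++ [j]}

/-- The maps of the associated hyperbolic system `S*`. -/
def associatedSystem (X : Set E) (φ : I → E → E) : AssociatedIndex X φ → E → E :=
  fun w => wordMap φ w.1

/-- A parabolic system is regular if the pressure of its associated hyperbolic system has a zero `t`
(the pressure of the parabolic system itself then vanishes at `t` too). The condition on the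
parabolic system alone would not do, as its pressure is constantly `0` on a half-line. -/
def IsRegularParabolic (X : Set E) (φ : I → E → E) : Prop :=
  ∃ t : ℝ, 0 ≤ t ∧ HasPressure X φ t 0 ∧ HasPressure X (associatedSystem X φ) t 0

end Systems

/-- The maps `φ_b(x) = 1 / (b - x)`, `b ≥ 2`, of the backward continued fraction system. -/
noncomputable def bcf (b : {b : ℕ // 2 ≤ b}) (x : ℝ) : ℝ := 1 / ((b.1 : ℝ) - x)

/-!
The composite `φ_w` along a word `w = b₁ ⋯ bₙ` is a Möbius map of determinant one with denominator
`D_w(x) = qₙ - qₙ₋₁ x`, where the continuants satisfy `qₙ = bₙ qₙ₋₁ - qₙ₋₂`. Hence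
`φ_w(y) - φ_w(x) = (y - x) / (D_w(x) D_w(y))` wherever `D_w > 0` (`wordMap_sub`), and
`φ_w' = 1 / D_w²`; everything reduces to inequalities between consecutive continuants
(`continuant_bounds`).

*Conformal extension.* On `V = (-1/10, 11/10)` the formulas `1 / (b - x)` serve as extensions. The
only bad words are those ending in `22` and the word `2`; for the admissible ones
`qₙ₋₁ ≤ 2 qₙ / 3` and `D_w ≥ 6 / 5` on `V` (`continuant_of_admissible`), which gives bounded
distortion and uniform contraction, and `φ_w(V) ⊆ [0, 1]`.

*Regularity.* The pressures vanish at `t = 1`. The intervals `φ_w([0, 1])`, for words of a given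
length in either system, fill `[0, 1]` up to a countable set, so their lengths sum to one
(`tsum_cylLength_flatten`, by telescoping over the letters). The norm `‖φ_w'‖` is at least the length
of `φ_w([0, 1])`, and exceeds it by a factor `D_w(0) / D_w(1)`, which is at most `n + 1` for words
of length `n` and at most `2` for the associated system. So the partition functions at `t = 1` grow
at most linearly (`hasPressure_zero`).

*Dimension.* Intervals of order `n` have length at most `1 / (n + 1)`, and every irrational number in
`(0, 1)` has an infinite expansion, so the limit set contains all of them
(`irrational_mem_limitSet`) and is not a null set.
-/

/-! ### Words as Möbius maps -/

/-- The integers `b ≥ 2`, the alphabet of the system. -/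
abbrev Digit : Type := {b : ℕ // 2 ≤ b}

/-- The pair `(qₙ, qₙ₋₁)` of continuants of a word `b₁ ⋯ bₙ`, given by `q₋₁ = 0`, `q₀ = 1` and
`qₙ = bₙ qₙ₋₁ - qₙ₋₂`. The map `φ_{b₁ ⋯ bₙ}` is a Möbius map of determinant one with denominator
`qₙ - qₙ₋₁ x`. -/
def continuant (w : List Digit) : ℝ × ℝ :=
  w.foldl (fun p b => ((b.1 : ℝ) * p.1 - p.2, p.1)) (1, 0)

/-- The denominator `qₙ - qₙ₋₁ x` of the Möbius map `φ_w`. -/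
def denom (w : List Digit) (x : ℝ) : ℝ := (continuant w).1 - (continuant w).2 * x

/-- The length `φ_w(1) - φ_w(0)` of the interval `φ_w([0, 1])`, in terms of denominators. -/
noncomputable def cylLength (w : List Digit) : ℝ := 1 / (denom w 0 * denom w 1)

theorem wordMap_append {I E : Type*} (φ : I → E → E) (v w : List I) :
    wordMap φ (v ++ w) = wordMap φ v ∘ wordMap φ w := by
  induction v with
  | nil => rfl
  | cons i v ih => rw [List.cons_append, wordMap, wordMap, ih, Function.comp_assoc]

theorem wordMap_snoc_apply {I E : Type*} (φ : I → E → E) (v : List I) (i : I) (x : E) :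
    wordMap φ (v ++ [i]) x = wordMap φ v (φ i x) := by
  rw [wordMap_append]; rfl

theorem continuant_snoc (v : List Digit) (b : Digit) :
    continuant (v ++ [b]) = ((b.1 : ℝ) * (continuant v).1 - (continuant v).2, (continuant v).1) := by
  simp [continuant]

theorem two_le_digit (b : Digit) : (2 : ℝ) ≤ b.1 := by exact_mod_cast b.2

theorem three_le_digit {b : Digit} (hb : b ≠ ⟨2, le_refl 2⟩) : (3 : ℝ) ≤ b.1 := by
  have h1 : b.1 ≠ 2 := fun h => hb (Subtype.ext h)
  have h2 := b.2
  exact_mod_cast (by omega : 3 ≤ b.1)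

/-- The last inequality says that `φ_w'` varies by a factor of at most `(n + 1)²` on `[0, 1]`, for
every word of length `n`. The growth is linear and not bounded because of the words `2ⁿ`, for which
`qₙ = n + 1`. -/
theorem continuant_bounds (w : List Digit) :
    0 ≤ (continuant w).2 ∧ (continuant w).2 + 1 ≤ (continuant w).1 ∧
    (w.length : ℝ) + 1 ≤ (continuant w).1 ∧
    (continuant w).1 ≤ (w.length + 1) * ((continuant w).1 - (continuant w).2) := by
  induction w using List.reverseRecOn with
  | nil => simp [continuant]
  | append_singleton v b ih =>
    obtain ⟨h1, h2, h3, h4⟩ := ih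
    have hb := two_le_digit b
    rw [continuant_snoc]
    simp only [List.length_append, List.length_singleton, Nat.cast_add, Nat.cast_one]
    set d := (continuant v).1
    set c := (continuant v).2
    set n : ℝ := (v.length : ℝ)
    have hn : 0 ≤ n := Nat.cast_nonneg _
    have hd : 0 ≤ ((b.1 : ℝ) - 2) * d := mul_nonneg (by linarith) (by linarith)
    have hnd := mul_nonneg hn hd
    refine ⟨by linarith, by linarith, by linarith, by linarith⟩

theorem denom_snoc (v : List Digit) (b : Digit) {x : ℝ} (hx : (b.1 : ℝ) - x ≠ 0) :
    denom (v ++ [b]) x = denom v (bcf b x) * (b.1 - x) := by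
  rw [denom, denom, continuant_snoc, bcf]
  field_simp
  ring

/-- On `x ≤ 1` the denominators are at least one. -/
theorem one_le_denom (w : List Digit) {x : ℝ} (hx : x ≤ 1) : 1 ≤ denom w x := by
  obtain ⟨h1, h2, -, -⟩ := continuant_bounds w
  have := mul_nonneg h1 (sub_nonneg.2 hx)
  rw [denom]; linarith

/-- The pole of `φ_{vb}` lies at or to the left of the pole `b` of `φ_b`. -/
theorem lt_digit_of_denom_pos {v : List Digit} {b : Digit} {x : ℝ}
    (h : 0 < denom (v ++ [b]) x) : 0 < (b.1 : ℝ) - x := by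
  obtain ⟨h1, h2, -, -⟩ := continuant_bounds v
  rw [denom, continuant_snoc] at h
  by_contra! hx
  have := mul_nonneg (by linarith : 0 ≤ (continuant v).1) (neg_nonneg.2 hx)
  dsimp only at h
  linarith

/-- The increment of a Möbius map of determinant one. Positivity of the denominator of `φ_w` at `x`
keeps all intermediate points of the orbit of `x` away from the poles of the letters. -/
theorem wordMap_sub (w : List Digit) {x y : ℝ} (hx : 0 < denom w x) (hy : 0 < denom w y) :
    wordMap bcf w y - wordMap bcf w x = (y - x) / (denom w x * denom w y) := by
  induction w using List.reverseRecOn generalizing x y with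
  | nil => simp [wordMap, denom, continuant]
  | append_singleton v b ih =>
    have hbx := lt_digit_of_denom_pos hx
    have hby := lt_digit_of_denom_pos hy
    rw [denom_snoc v b hbx.ne'] at hx ⊢
    rw [denom_snoc v b hby.ne'] at hy ⊢
    have hx' := pos_of_mul_pos_left hx hbx.le
    have hy' := pos_of_mul_pos_left hy hby.le
    rw [wordMap_snoc_apply, wordMap_snoc_apply, ih hx' hy']
    have h : bcf b y - bcf b x = (y - x) / ((b.1 - x) * (b.1 - y)) := by
      rw [bcf, bcf]; field_simp; ring
    rw [h]
    field_simp

theorem isOpen_denom_pos (w : List Digit) : IsOpen {x | 0 < denom w x} :=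
  isOpen_lt continuous_const (by unfold denom; fun_prop)

theorem hasDerivAt_wordMap (w : List Digit) {x : ℝ} (hx : 0 < denom w x) :
    HasDerivAt (wordMap bcf w) (1 / denom w x ^ 2) x := by
  have hd : HasDerivAt (denom w) (-(continuant w).2) x := by
    unfold denom
    simpa using ((hasDerivAt_id x).const_mul (continuant w).2).const_sub (continuant w).1
  have h := (((hasDerivAt_id x).sub_const x).div (hd.const_mul (denom w x))
    (mul_pos hx hx).ne').const_add (wordMap bcf w x)
  refine (h.congr_of_eventuallyEq ?_).congr_deriv ?_
  · filter_upwards [(isOpen_denom_pos w).mem_nhds hx] with y hy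
    have := wordMap_sub w hx hy
    simp only [id, Pi.div_apply]
    linarith
  · simp
    field_simp

theorem contDiffOn_wordMap (w : List Digit) : ContDiffOn ℝ 1 (wordMap bcf w) {x | 0 < denom w x} := by
  have h0 : 0 < denom w 0 := one_pos.trans_le (one_le_denom w zero_le_one)
  have h : ContDiffOn ℝ 1 (fun y => wordMap bcf w 0 + y / (denom w 0 * denom w y))
      {x | 0 < denom w x} := by
    refine contDiffOn_const.add (contDiffOn_id.div ?_ fun y hy => (mul_pos h0 hy).ne')
    unfold denom
    fun_prop
  refine h.congr fun y hy => ?_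
  have := wordMap_sub w h0 hy
  rw [sub_zero] at this
  linarith

theorem bcf_injective (b : Digit) : Function.Injective (bcf b) := fun x y h => by
  simpa [bcf] using h

theorem wordMap_bcf_injective (w : List Digit) : Function.Injective (wordMap bcf w) := by
  induction w with
  | nil => exact Function.injective_id
  | cons b w ih => exact (bcf_injective b).comp ih

theorem isConformalOn_wordMap (w : List Digit) {U : Set ℝ} (hU : ∀ x ∈ U, 0 < denom w x) :
    IsConformalOn (wordMap bcf w) U := by
  refine ⟨(contDiffOn_wordMap w).mono hU, (wordMap_bcf_injective w).injOn, fun x hx => ?_⟩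
  refine ⟨_, (hasDerivAt_wordMap w (hU x hx)).hasFDerivAt, 1 / denom w x ^ 2, ?_, .id, ?_⟩
  · have := hU x hx
    positivity
  · ext; simp

/-! ### Derivatives and lengths of cylinders -/

theorem norm_fderiv_wordMap (w : List Digit) {x : ℝ} (hx : 0 < denom w x) :
    ‖fderiv ℝ (wordMap bcf w) x‖ = 1 / denom w x ^ 2 := by
  rw [← norm_deriv_eq_norm_fderiv, (hasDerivAt_wordMap w hx).deriv,
    Real.norm_of_nonneg (by positivity)]

theorem norm_fderivWithin_wordMap (w : List Digit) {x : ℝ} (hx : x ∈ Set.Icc (0 : ℝ) 1) :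
    ‖fderivWithin ℝ (wordMap bcf w) (Set.Icc 0 1) x‖ = 1 / denom w x ^ 2 := by
  have h := one_pos.trans_le (one_le_denom w hx.2)
  rw [(hasDerivAt_wordMap w h).differentiableAt.fderivWithin (uniqueDiffOn_Icc one_pos x hx),
    norm_fderiv_wordMap w h]

/-- The derivative of `φ_w` is increasing on `[0, 1]`. -/
theorem derivNorm_wordMap (w : List Digit) :
    derivNorm (Set.Icc 0 1) (wordMap bcf w) = ENNReal.ofReal (1 / denom w 1 ^ 2) := by
  have h1 : 1 ≤ denom w 1 := one_le_denom w le_rfl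
  have hr : (1 : ℝ) ∈ Set.Icc (0 : ℝ) 1 := Set.right_mem_Icc.2 zero_le_one
  refine le_antisymm (iSup₂_le fun x hx => ?_) (le_iSup₂_of_le 1 hr ?_)
  · rw [← ofReal_norm, norm_fderivWithin_wordMap w hx]
    refine ENNReal.ofReal_le_ofReal (one_div_le_one_div_of_le (by positivity)
      (pow_le_pow_left₀ (by positivity) ?_ 2))
    have := mul_nonneg (continuant_bounds w).1 (sub_nonneg.2 hx.2)
    rw [denom, denom]; linarith
  · rw [← ofReal_norm, norm_fderivWithin_wordMap w hr]

theorem wordMap_singleton (b : Digit) : wordMap bcf [b] = bcf b := rfl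

theorem denom_singleton (b : Digit) (x : ℝ) : denom [b] x = b.1 - x := by
  simp [denom, continuant]

theorem bcf_mapsTo (b : Digit) : Set.MapsTo (bcf b) (Set.Icc 0 1) (Set.Icc 0 1) := fun x hx => by
  have hb := two_le_digit b
  have hx2 := hx.2
  exact ⟨one_div_nonneg.2 (by linarith), (div_le_one (by linarith)).2 (by linarith)⟩

theorem wordMap_mapsTo (w : List Digit) :
    Set.MapsTo (wordMap bcf w) (Set.Icc 0 1) (Set.Icc 0 1) := by
  induction w with
  | nil => exact Set.mapsTo_id _
  | cons b w ih => exact (bcf_mapsTo b).comp ih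

theorem wordMap_monotoneOn (w : List Digit) : MonotoneOn (wordMap bcf w) (Set.Iic 1) :=
  fun x hx y hy hxy => by
    have h1 := one_pos.trans_le (one_le_denom w hx)
    have h2 := one_pos.trans_le (one_le_denom w hy)
    have h := wordMap_sub w h1 h2
    have : 0 ≤ (y - x) / (denom w x * denom w y) := div_nonneg (sub_nonneg.2 hxy) (by positivity)
    linarith

theorem cylLength_eq (w : List Digit) : cylLength w = wordMap bcf w 1 - wordMap bcf w 0 := by
  rw [wordMap_sub w (one_pos.trans_le (one_le_denom w zero_le_one))
    (one_pos.trans_le (one_le_denom w le_rfl)), sub_zero, cylLength]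

theorem cylLength_le (w : List Digit) : cylLength w ≤ 1 / (w.length + 1) := by
  have h1 := one_le_denom w le_rfl
  have h3 := (continuant_bounds w).2.2.1
  have h0 : (w.length : ℝ) + 1 ≤ denom w 0 := by simpa [denom] using h3
  refine one_div_le_one_div_of_le (by positivity) (h0.trans ?_)
  exact le_mul_of_one_le_right (by linarith [one_le_denom w zero_le_one]) h1

theorem cylLength_le_derivNorm (w : List Digit) :
    ENNReal.ofReal (cylLength w) ≤ derivNorm (Set.Icc 0 1) (wordMap bcf w) := by
  rw [derivNorm_wordMap, cylLength, sq]
  have h1 := one_le_denom w le_rfl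
  have hc := (continuant_bounds w).1
  refine ENNReal.ofReal_le_ofReal (one_div_le_one_div_of_le (by positivity) ?_)
  refine mul_le_mul_of_nonneg_right ?_ (by linarith)
  rw [denom, denom]; linarith

/-- Here `‖φ_w'‖ = 1 / D(1)²` and the length is `1 / (D(0) D(1))`, where `D` is the denominator, so
the two differ by the factor `D(0) / D(1)`. -/
theorem derivNorm_le_mul_cylLength {w : List Digit} {C : ℝ} (hC : denom w 0 ≤ C * denom w 1) :
    derivNorm (Set.Icc 0 1) (wordMap bcf w) ≤ ENNReal.ofReal C * ENNReal.ofReal (cylLength w) := by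
  have h1 := one_le_denom w le_rfl
  have h0 := one_le_denom w zero_le_one
  have hC0 : 0 ≤ C := by
    by_contra! h
    have := mul_neg_of_neg_of_pos h (one_pos.trans_le h1)
    linarith
  rw [derivNorm_wordMap, cylLength, ← ENNReal.ofReal_mul hC0]
  refine ENNReal.ofReal_le_ofReal ?_
  rw [mul_one_div, div_le_div_iff₀ (by positivity) (by positivity), sq]
  have := mul_le_mul_of_nonneg_right hC (by linarith : 0 ≤ denom w 1)
  linarith

/-! ### Partitions into cylinders -/

open Filter Topology in
theorem tsum_ofReal_telescope {u : ℕ → ℝ} (hu : Monotone u) {l : ℝ} (hl : Tendsto u atTop (𝓝 l)) :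
    ∑' n, ENNReal.ofReal (u (n + 1) - u n) = ENNReal.ofReal (l - u 0) := by
  have hnn : ∀ n, 0 ≤ u (n + 1) - u n := fun n => sub_nonneg.2 (hu n.le_succ)
  have h : HasSum (fun n => u (n + 1) - u n) (l - u 0) := by
    rw [hasSum_iff_tendsto_nat_of_nonneg hnn]
    simp_rw [Finset.sum_range_sub]
    exact hl.sub_const _
  rw [← ENNReal.ofReal_tsum_of_nonneg hnn h.summable, h.tsum_eq]

theorem cylLength_snoc (v : List Digit) (b : Digit) :
    cylLength (v ++ [b]) = wordMap bcf v (1 / (b.1 - 1)) - wordMap bcf v (1 / b.1) := by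
  rw [cylLength_eq, wordMap_snoc_apply, wordMap_snoc_apply, bcf, bcf, sub_zero]

open Filter Topology in
/-- The intervals `φ_v([1 / b, 1 / (b - 1)])` with `b ≥ m + 2` fill `φ_v([0, 1 / (m + 1)])`. -/
theorem tsum_cylLength_digits (v : List Digit) (m : ℕ) :
    ∑' k : ℕ, ENNReal.ofReal (cylLength (v ++ [⟨k + m + 2, by omega⟩])) =
      ENNReal.ofReal (wordMap bcf v (1 / (m + 1)) - wordMap bcf v 0) := by
  set u : ℕ → ℝ := fun k => -wordMap bcf v (1 / ((k : ℝ) + m + 1)) with hu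
  have hle : ∀ k : ℕ, 1 / ((k : ℝ) + m + 1) ≤ 1 := fun k =>
    (div_le_one (by positivity)).2 (by
      linarith [Nat.cast_nonneg (α := ℝ) k, Nat.cast_nonneg (α := ℝ) m])
  have hmono : Monotone u := monotone_nat_of_le_succ fun k => neg_le_neg <|
    wordMap_monotoneOn v (hle (k + 1)) (hle k)
      (one_div_le_one_div_of_le (by positivity) (by push_cast; linarith))
  have hlim : Tendsto u atTop (𝓝 (-wordMap bcf v 0)) := by
    have h0 := (hasDerivAt_wordMap v (one_pos.trans_le (one_le_denom v zero_le_one))).continuousAt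
    have h1 : Tendsto (fun k : ℕ => 1 / ((k : ℝ) + m + 1)) atTop (𝓝 0) := by
      simp_rw [one_div]
      refine tendsto_inv_atTop_zero.comp ?_
      simp_rw [add_assoc]
      exact tendsto_atTop_add_const_right _ _ tendsto_natCast_atTop_atTop
    exact (h0.tendsto.comp h1).neg
  have h := tsum_ofReal_telescope hmono hlim
  have h0 : u 0 = -wordMap bcf v (1 / (m + 1)) := by simp [hu]
  rw [h0, neg_sub_neg] at h
  rw [← h]
  refine tsum_congr fun k => ?_
  rw [cylLength_snoc, hu]
  dsimp only
  rw [neg_sub_neg]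
  push_cast
  ring_nf

/-- The letters `b` form a partition of every cylinder, up to a countable set. -/
theorem tsum_cylLength_snoc (v : List Digit) :
    ∑' b : Digit, ENNReal.ofReal (cylLength (v ++ [b])) = ENNReal.ofReal (cylLength v) := by
  let e : ℕ ≃ Digit :=
    ⟨fun k => ⟨k + 2, by omega⟩, fun b => b.1 - 2, fun k => by simp, fun b => by
      have := b.2
      ext
      simp
      omega⟩
  rw [← e.tsum_eq]
  have h := tsum_cylLength_digits v 0
  simp only [Nat.cast_zero, zero_add, div_one, ← cylLength_eq] at h
  exact h

/-- The parabolic letter. -/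
def two : Digit := ⟨2, le_refl 2⟩

/-- The word `2ⁿ j` with `j = m + 3`. -/
def blockWord (p : ℕ × ℕ) : List Digit := List.replicate p.1 two ++ [⟨p.2 + 3, by omega⟩]

theorem bcf_two_one : bcf two 1 = 1 := by norm_num [bcf, two]

theorem wordMap_replicate_two_one (n : ℕ) : wordMap bcf (List.replicate n two) 1 = 1 := by
  induction n with
  | zero => rfl
  | succ n ih => rw [List.replicate_succ, wordMap, Function.comp_apply, ih, bcf_two_one]

open Filter Topology in
/-- The words `2ⁿ j` with `j ≥ 3` form a partition of every cylinder, up to a countable set. -/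
theorem tsum_cylLength_blockWord (v : List Digit) :
    ∑' p : ℕ × ℕ, ENNReal.ofReal (cylLength (v ++ blockWord p)) = ENNReal.ofReal (cylLength v) := by
  -- The blocks with `n` letters `2` fill the interval from `φ_{v 2ⁿ}(0)` to
  -- `φ_{v 2ⁿ}(1 / 2) = φ_{v 2ⁿ⁺¹}(0)`, and the latter point tends to `φ_v(1)`.
  set u : ℕ → ℝ := fun n => wordMap bcf (v ++ List.replicate n two) 0 with hu
  have hone : ∀ n, wordMap bcf (v ++ List.replicate n two) 1 = wordMap bcf v 1 := fun n => by
    rw [wordMap_append, Function.comp_apply, wordMap_replicate_two_one]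
  have hstep : ∀ n, u (n + 1) = wordMap bcf (v ++ List.replicate n two) (1 / 2) := fun n => by
    rw [hu]
    dsimp only
    rw [List.replicate_succ', ← List.append_assoc, wordMap_snoc_apply]
    norm_num [bcf, two]
  have hmono : Monotone u := monotone_nat_of_le_succ fun n => by
    rw [hstep]
    refine wordMap_monotoneOn _ ?_ ?_ ?_ <;> norm_num
  have hlen : ∀ n, u n = wordMap bcf v 1 - cylLength (v ++ List.replicate n two) := fun n => by
    rw [cylLength_eq, hone, sub_sub_cancel]
  have hlim : Tendsto u atTop (𝓝 (wordMap bcf v 1)) := by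
    have h0 : Tendsto (fun n => cylLength (v ++ List.replicate n two)) atTop (𝓝 0) := by
      refine squeeze_zero (fun n => ?_) (fun n => ?_) tendsto_one_div_add_atTop_nhds_zero_nat
      · have h1 := one_le_denom (v ++ List.replicate n two) le_rfl
        have h2 := one_le_denom (v ++ List.replicate n two) zero_le_one
        rw [cylLength]; positivity
      · refine (cylLength_le _).trans (one_div_le_one_div_of_le (by positivity) ?_)
        simp
    simpa only [← hlen, sub_zero] using h0.const_sub (wordMap bcf v 1)
  rw [ENNReal.tsum_prod (f := fun n m => ENNReal.ofReal (cylLength (v ++ blockWord (n, m))))]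
  have h := tsum_ofReal_telescope hmono hlim
  have h0 : u 0 = wordMap bcf v 0 := by simp [hu]
  rw [h0, ← cylLength_eq] at h
  rw [← h]
  refine tsum_congr fun n => ?_
  have hn := tsum_cylLength_digits (v ++ List.replicate n two) 1
  simp only [Nat.cast_one, one_add_one_eq_two, ← hstep] at hn
  rw [← hn]
  refine tsum_congr fun k => ?_
  rw [blockWord, ← List.append_assoc]

/-- If the words `W a` partition every cylinder, then so do their concatenations of given length. -/
theorem tsum_cylLength_flatten {A : Type*} (W : A → List Digit)
    (hW : ∀ v, ∑' a, ENNReal.ofReal (cylLength (v ++ W a)) = ENNReal.ofReal (cylLength v)) (n : ℕ) :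
    ∑' ω : Fin n → A, ENNReal.ofReal (cylLength ((List.ofFn ω).map W).flatten) = 1 := by
  induction n with
  | zero =>
    rw [tsum_eq_single (fun i => i.elim0) fun b hb => (hb (Subsingleton.elim _ _)).elim]
    simp [cylLength, denom, continuant]
  | succ n ih =>
    rw [← (Fin.snocEquiv fun _ : Fin (n + 1) => A).tsum_eq, ← (Equiv.prodComm _ _).tsum_eq]
    refine (ENNReal.tsum_prod (f := fun ω a => ENNReal.ofReal
      (cylLength ((List.ofFn (Fin.snocEquiv (fun _ => A) (a, ω))).map W).flatten))).trans ?_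
    rw [← ih]
    refine tsum_congr fun ω => ?_
    rw [← hW]
    refine tsum_congr fun a => ?_
    rw [List.ofFn_succ', List.concat_eq_append]
    simp [Fin.snocEquiv]

/-! ### Pressure -/

open Filter Topology in
/-- The pressure vanishes if the partition functions lie between `1` and a linear function. -/
theorem hasPressure_zero {I : Type*} (X : Set ℝ) (φ : I → ℝ → ℝ) (t : ℝ)
    (h1 : ∀ n, 1 ≤ partitionFunction X φ n t)
    (h2 : ∀ n : ℕ, partitionFunction X φ n t ≤ ENNReal.ofReal (n + 2)) : HasPressure X φ t 0 := by
  have hlim : Tendsto (fun n : ℕ => Real.log ((n : ℝ) + 2) / n) atTop (𝓝 0) := by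
    have ha : Tendsto (fun n : ℕ => (n : ℝ) + 2) atTop atTop :=
      tendsto_atTop_add_const_right _ _ tendsto_natCast_atTop_atTop
    -- With `x = n + 2`, the denominator is `x - 2`.
    have hb : Tendsto (fun x : ℝ => Real.log x / (1 * x + (-2))) atTop (𝓝 0) := by
      simpa using Real.tendsto_pow_log_div_mul_add_atTop 1 (-2) 1 one_ne_zero
    refine (hb.comp ha).congr fun n => ?_
    simp
  have hE : Tendsto (fun n : ℕ => ((Real.log ((n : ℝ) + 2) / n : ℝ) : EReal)) atTop (𝓝 0) := by
    exact_mod_cast (continuous_coe_real_ereal.tendsto 0).comp hlim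
  refine tendsto_of_tendsto_of_tendsto_of_le_of_le tendsto_const_nhds hE (fun n => ?_) fun n => ?_
  · refine EReal.div_nonneg ?_ (by exact_mod_cast Nat.zero_le n)
    rw [← ENNReal.log_one]
    exact ENNReal.log_monotone (h1 n)
  · have h3 := ENNReal.log_monotone (h2 n)
    rw [ENNReal.log_ofReal_of_pos (by positivity)] at h3
    rw [EReal.coe_div]
    exact EReal.div_le_div_right_of_nonneg (by exact_mod_cast Nat.zero_le n) h3

theorem hasPressure_bcf : HasPressure (Set.Icc (0 : ℝ) 1) bcf 1 0 := by
  have hlen : ∀ n, ∑' ω : Fin n → Digit, ENNReal.ofReal (cylLength (List.ofFn ω)) = 1 := fun n => by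
    simpa only [← List.flatMap_def, List.flatMap_singleton'] using
      tsum_cylLength_flatten (fun b : Digit => [b]) tsum_cylLength_snoc n
  refine hasPressure_zero _ _ _ (fun n => ?_) fun n => ?_
  · rw [← hlen n]
    refine ENNReal.tsum_le_tsum fun ω => ?_
    rw [ENNReal.rpow_one]
    exact cylLength_le_derivNorm _
  · rw [← mul_one (ENNReal.ofReal _), ← hlen n, ← ENNReal.tsum_mul_left]
    refine ENNReal.tsum_le_tsum fun ω => ?_
    rw [ENNReal.rpow_one]
    refine derivNorm_le_mul_cylLength ?_
    have h := (continuant_bounds (List.ofFn ω)).2.2.2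
    have h1 := one_le_denom (List.ofFn ω) le_rfl
    simp only [denom, List.length_ofFn, mul_zero, mul_one, sub_zero] at h h1 ⊢
    linarith

/-- The denominator of `φ_w` varies by a factor of at most `2` on `[0, 1]` if the last letter of `w` is not parabolic. -/
theorem denom_zero_le_of_last {v : List Digit} {j : Digit} (hj : j ≠ two) :
    denom (v ++ [j]) 0 ≤ 2 * denom (v ++ [j]) 1 := by
  have h3 := three_le_digit hj
  obtain ⟨h1, h2, -, -⟩ := continuant_bounds v
  have := mul_nonneg (sub_nonneg.2 h3) (by linarith : 0 ≤ (continuant v).1)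
  rw [denom, denom, continuant_snoc]
  dsimp only
  linarith

/-! ### The parabolic index -/

theorem isParabolicPair_iff (b : Digit) (x : ℝ) :
    IsParabolicPair (Set.Icc (0 : ℝ) 1) bcf b x ↔ b.1 = 2 ∧ x = 1 := by
  constructor
  · rintro ⟨hx, -, -, h⟩
    rw [← wordMap_singleton b, norm_fderivWithin_wordMap _ hx, denom_singleton] at h
    have hb := two_le_digit b
    have h1 : 1 ≤ (b.1 : ℝ) - x := by linarith [hx.2]
    have h2 : (b.1 : ℝ) - x = 1 := by
      have : ((b.1 : ℝ) - x) ^ 2 = 1 := by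
        have := (div_eq_one_iff_eq (by positivity)).1 h
        exact this.symm
      nlinarith
    exact ⟨by exact_mod_cast (by linarith [hx.2] : (b.1 : ℝ) = 2), by linarith [hx.2]⟩
  · rintro ⟨hb, rfl⟩
    obtain rfl : b = two := Subtype.ext hb
    have hr : (1 : ℝ) ∈ Set.Icc (0 : ℝ) 1 := Set.right_mem_Icc.2 zero_le_one
    refine ⟨hr, bcf_two_one, fun y hy h => ?_, ?_⟩
    · have h2 : (2 : ℝ) - y ≠ 0 := by linarith [hy.2]
      have h3 : y * (2 - y) = 1 := by
        rw [bcf, div_eq_iff (by simpa [two] using h2)] at h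
        simpa [two] using h.symm
      have : (y - 1) ^ 2 = 0 := by linarith
      have := pow_eq_zero_iff (two_ne_zero) |>.1 this
      linarith
    · rw [← wordMap_singleton two, norm_fderivWithin_wordMap _ hr, denom_singleton]
      norm_num [two]

theorem parabolicIndices_bcf : parabolicIndices (Set.Icc (0 : ℝ) 1) bcf = {two} := by
  ext b
  simp only [parabolicIndices, isParabolicPair_iff, Set.mem_ofPred_eq, Set.mem_singleton_iff]
  exact ⟨fun ⟨_, h, _⟩ => Subtype.ext h, fun h => ⟨1, by rw [h]; rfl, rfl⟩⟩

/-! ### The associated system -/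

/-- A letter of the associated system, as a word of the original one. -/
def associatedWord {X : Set ℝ} (a : AssociatedIndex X bcf) : List Digit := a.1

theorem wordMap_associatedSystem (X : Set ℝ) (l : List (AssociatedIndex X bcf)) :
    wordMap (associatedSystem X bcf) l = wordMap bcf (l.map associatedWord).flatten := by
  induction l with
  | nil => rfl
  | cons a l ih =>
    rw [List.map_cons, List.flatten_cons, wordMap_append, wordMap, ih]
    rfl

theorem blockWord_injective : Function.Injective blockWord := by
  rintro ⟨n, m⟩ ⟨n', m'⟩ h
  have h1 := congrArg List.length h
  simp only [blockWord, List.length_append, List.length_replicate, List.length_singleton] at h1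
  obtain rfl : n = n' := by omega
  have h2 := List.append_cancel_left h
  simp at h2
  rw [h2]

/-- The words `2ⁿ j` with `j ≥ 3` are exactly the letters of the associated system. -/
theorem range_blockWord : Set.range blockWord =
    {w | (∃ k, k ∉ parabolicIndices (Set.Icc (0 : ℝ) 1) bcf ∧ w = [k]) ∨
      ∃ i ∈ parabolicIndices (Set.Icc (0 : ℝ) 1) bcf, ∃ j, j ≠ i ∧ ∃ n : ℕ, 1 ≤ n ∧
        w = List.replicate n i ++ [j]} := by
  have hj : ∀ j : Digit, j ≠ two → ∃ m, j = ⟨m + 3, Nat.le_add_left 2 (m + 1)⟩ := fun j hj => by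
    have h1 : j.1 ≠ 2 := fun h => hj (Subtype.ext h)
    have h2 := j.2
    exact ⟨j.1 - 3, Subtype.ext (by dsimp only; omega)⟩
  have hj' : ∀ m : ℕ, (⟨m + 3, by omega⟩ : Digit) ≠ two := fun m h => by
    have := congrArg Subtype.val h
    simp [two] at this
  rw [parabolicIndices_bcf]
  ext w
  constructor
  · rintro ⟨⟨n, m⟩, rfl⟩
    rcases Nat.eq_zero_or_pos n with rfl | hn
    · exact Or.inl ⟨_, hj' m, rfl⟩
    · exact Or.inr ⟨two, rfl, _, hj' m, n, hn, rfl⟩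
  · rintro (⟨k, hk, rfl⟩ | ⟨i, rfl, j, hne, n, -, rfl⟩)
    · obtain ⟨m, rfl⟩ := hj k hk
      exact ⟨(0, m), rfl⟩
    · obtain ⟨m, rfl⟩ := hj j hne
      exact ⟨(n, m), rfl⟩

theorem tsum_cylLength_associated (v : List Digit) :
    ∑' a : AssociatedIndex (Set.Icc (0 : ℝ) 1) bcf, ENNReal.ofReal (cylLength (v ++ associatedWord a)) =
      ENNReal.ofReal (cylLength v) := by
  rw [← tsum_cylLength_blockWord v]
  rw [← tsum_range (fun w => ENNReal.ofReal (cylLength (v ++ w))) blockWord_injective,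
    range_blockWord]
  rfl

theorem associatedIndex_eq_snoc (a : AssociatedIndex (Set.Icc (0 : ℝ) 1) bcf) :
    ∃ v j, j ≠ two ∧ associatedWord a = v ++ [j] := by
  have ha : associatedWord a ∈ Set.range blockWord := by
    rw [range_blockWord]
    exact a.2
  obtain ⟨p, hp⟩ := ha
  refine ⟨_, _, fun h => ?_, hp.symm⟩
  have := congrArg Subtype.val h
  simp [two] at this

theorem denom_zero_le_flatten (l : List (AssociatedIndex (Set.Icc (0 : ℝ) 1) bcf)) :
    denom (l.map associatedWord).flatten 0 ≤ 2 * denom (l.map associatedWord).flatten 1 := by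
  rcases List.eq_nil_or_concat' l with rfl | ⟨l, a, rfl⟩
  · simp [denom, continuant]
  · obtain ⟨v, j, hj, h⟩ := associatedIndex_eq_snoc a
    simp only [List.map_append, List.map_cons, List.map_nil, List.flatten_append,
      List.flatten_cons, List.flatten_nil, List.append_nil, h, ← List.append_assoc]
    exact denom_zero_le_of_last hj

theorem hasPressure_associatedSystem :
    HasPressure (Set.Icc (0 : ℝ) 1) (associatedSystem (Set.Icc (0 : ℝ) 1) bcf) 1 0 := by
  have hlen := tsum_cylLength_flatten _ tsum_cylLength_associated
  refine hasPressure_zero _ _ _ (fun n => ?_) fun n => ?_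
  · rw [← hlen n]
    refine ENNReal.tsum_le_tsum fun ω => ?_
    rw [ENNReal.rpow_one, wordMap_associatedSystem]
    exact cylLength_le_derivNorm _
  · rw [← mul_one (ENNReal.ofReal _), ← hlen n, ← ENNReal.tsum_mul_left]
    refine ENNReal.tsum_le_tsum fun ω => ?_
    rw [ENNReal.rpow_one, wordMap_associatedSystem]
    refine derivNorm_le_mul_cylLength ((denom_zero_le_flatten _).trans ?_)
    have h1 := one_le_denom ((List.ofFn ω).map associatedWord).flatten le_rfl
    exact mul_le_mul_of_nonneg_right (by linarith [Nat.cast_nonneg (α := ℝ) n]) (by linarith)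

theorem isRegularParabolic_bcf : IsRegularParabolic (Set.Icc (0 : ℝ) 1) bcf :=
  ⟨1, zero_le_one, hasPressure_bcf, hasPressure_associatedSystem⟩

/-! ### The conformal extension to `(-1/10, 11/10)` -/

/-- If the last letter is not `2`, then `2 qₙ₋₁ ≤ qₙ`. A final letter `2` after another letter spoils
this only a little. No such bounds hold along the words `2ⁿ`, where `qₙ₋₁ / qₙ = n / (n + 1)`. -/
theorem continuant_of_admissible {w : List Digit}
    (hw : IsAdmissibleWord (parabolicIndices (Set.Icc (0 : ℝ) 1) bcf) w) :
    3 * (continuant w).2 ≤ 2 * (continuant w).1 ∧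
      6 / 5 ≤ (continuant w).1 - 11 / 10 * (continuant w).2 := by
  have key : ∀ (v : List Digit) (j : Digit), j ≠ two →
      3 ≤ (continuant (v ++ [j])).1 ∧
        2 * (continuant (v ++ [j])).2 ≤ (continuant (v ++ [j])).1 ∧
        6 / 5 ≤ (continuant (v ++ [j])).1 - 11 / 10 * (continuant (v ++ [j])).2 := by
    intro v j hj
    have h3 := three_le_digit hj
    obtain ⟨h1, h2, -, -⟩ := continuant_bounds v
    have := mul_nonneg (sub_nonneg.2 h3) (by linarith : 0 ≤ (continuant v).1)
    rw [continuant_snoc]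
    exact ⟨by linarith, by linarith, by linarith⟩
  have key' : ∀ (v : List Digit) (j : Digit), j ≠ two →
      3 * (continuant (v ++ [j])).2 ≤ 2 * (continuant (v ++ [j])).1 ∧
        6 / 5 ≤ (continuant (v ++ [j])).1 - 11 / 10 * (continuant (v ++ [j])).2 := fun v j hj => by
    obtain ⟨h1, h2, h3⟩ := key v j hj
    exact ⟨by linarith, h3⟩
  rw [parabolicIndices_bcf] at hw
  obtain ⟨v, j, ⟨rfl, hj⟩ | ⟨k, hkj, rfl⟩⟩ := hw
  · exact key' v j hj
  · rw [List.append_cons]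
    by_cases hj : j = two
    · obtain rfl := hj
      obtain ⟨h1, h2, h3⟩ := key v k hkj
      rw [continuant_snoc]
      simp only [two, Nat.cast_ofNat]
      exact ⟨by linarith, by linarith⟩
    · exact key' _ j hj

theorem le_denom_of_admissible {w : List Digit}
    (hw : IsAdmissibleWord (parabolicIndices (Set.Icc (0 : ℝ) 1) bcf) w) {x : ℝ}
    (hx : x ∈ Set.Ioo (-(1 / 10) : ℝ) (11 / 10)) : 6 / 5 ≤ denom w x := by
  have h := mul_nonneg (continuant_bounds w).1 (sub_nonneg.2 hx.2.le)
  have h2 := (continuant_of_admissible hw).2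
  rw [denom]
  linarith

theorem denom_le_of_admissible {w : List Digit}
    (hw : IsAdmissibleWord (parabolicIndices (Set.Icc (0 : ℝ) 1) bcf) w) {x y : ℝ}
    (hx : x ∈ Set.Ioo (-(1 / 10) : ℝ) (11 / 10)) (hy : y ∈ Set.Ioo (-(1 / 10) : ℝ) (11 / 10)) :
    denom w x ≤ 4 * denom w y := by
  obtain ⟨h1, -⟩ := continuant_of_admissible hw
  obtain ⟨h2, h3, -, -⟩ := continuant_bounds w
  have h4 := mul_nonneg h2 (sub_nonneg.2 hx.1.le)
  have h5 := mul_nonneg h2 (sub_nonneg.2 hy.2.le)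
  rw [denom, denom]
  linarith

theorem wordMap_mapsTo_of_admissible {w : List Digit}
    (hw : IsAdmissibleWord (parabolicIndices (Set.Icc (0 : ℝ) 1) bcf) w) :
    Set.MapsTo (wordMap bcf w) (Set.Ioo (-(1 / 10) : ℝ) (11 / 10)) (Set.Icc 0 1) := by
  have key : ∀ (v : List Digit) (j : Digit), j ≠ two →
      Set.MapsTo (wordMap bcf (v ++ [j])) (Set.Ioo (-(1 / 10) : ℝ) (11 / 10)) (Set.Icc 0 1) := by
    intro v j hj x hx
    have h3 := three_le_digit hj
    have hx2 := hx.2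
    rw [wordMap_snoc_apply]
    exact wordMap_mapsTo v ⟨one_div_nonneg.2 (by linarith),
      (div_le_one (by linarith)).2 (by linarith)⟩
  rw [parabolicIndices_bcf] at hw
  obtain ⟨v, j, ⟨rfl, hj⟩ | ⟨k, hkj, rfl⟩⟩ := hw
  · exact key v j hj
  · rw [List.append_cons]
    by_cases hj : j = two
    · obtain rfl := hj
      intro x hx
      have h3 := three_le_digit hkj
      have hx2 := hx.2
      have h4 : bcf two x ≤ 2 := by
        simp only [bcf, two, Nat.cast_ofNat]
        exact (div_le_iff₀ (by linarith)).2 (by linarith)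
      rw [wordMap_snoc_apply, wordMap_snoc_apply]
      exact wordMap_mapsTo v ⟨one_div_nonneg.2 (by linarith),
        (div_le_one (by linarith)).2 (by linarith)⟩
    · exact key _ j hj

/-- The Hölder condition, with exponent `1`; the factor `1 / (b - 1)²` is `‖φ_b'‖`. -/
theorem holder_bcf (b : Digit) {x y : ℝ} (hx : x ∈ Set.Ioo (-(1 / 10) : ℝ) (11 / 10))
    (hy : y ∈ Set.Ioo (-(1 / 10) : ℝ) (11 / 10)) :
    |1 / ((b.1 : ℝ) - y) ^ 2 - 1 / (b.1 - x) ^ 2| ≤ 3 * (1 / (b.1 - 1) ^ 2) * |y - x| := by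
  have hb := two_le_digit b
  have hm : 0 < (b.1 : ℝ) - 1 := by linarith
  have key : ∀ z ∈ Set.Ioo (-(1 / 10) : ℝ) (11 / 10),
      0 < 1 / ((b.1 : ℝ) - z) ∧ 1 / ((b.1 : ℝ) - z) ≤ 10 / 9 * (1 / (b.1 - 1)) := fun z hz => by
    have h1 : 9 / 10 * ((b.1 : ℝ) - 1) ≤ b.1 - z := by linarith [hz.2]
    refine ⟨one_div_pos.2 (by linarith), ?_⟩
    rw [show 10 / 9 * (1 / ((b.1 : ℝ) - 1)) = 1 / (9 / 10 * (b.1 - 1)) by field_simp]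
    exact one_div_le_one_div_of_le (by linarith) h1
  obtain ⟨hu0, hu⟩ := key x hx
  obtain ⟨hv0, hv⟩ := key y hy
  have hm1 : 1 / ((b.1 : ℝ) - 1) ≤ 1 := (div_le_one hm).2 (by linarith)
  have hm0 : 0 < 1 / ((b.1 : ℝ) - 1) := one_div_pos.2 hm
  have hfac : 1 / ((b.1 : ℝ) - y) ^ 2 - 1 / (b.1 - x) ^ 2 = (1 / (b.1 - y) * (1 / (b.1 - x)) *
      (1 / (b.1 - y) + 1 / (b.1 - x))) * (y - x) := by
    have h1 : (b.1 : ℝ) - x ≠ 0 := (one_div_pos.1 hu0).ne'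
    have h2 : (b.1 : ℝ) - y ≠ 0 := (one_div_pos.1 hv0).ne'
    field_simp
    ring
  rw [hfac, abs_mul, abs_of_pos (by positivity)]
  refine mul_le_mul_of_nonneg_right ?_ (abs_nonneg _)
  rw [← one_div_pow]
  set m := 1 / ((b.1 : ℝ) - 1)
  calc _ ≤ (10 / 9 * m * (10 / 9 * m)) * (10 / 9 * m + 10 / 9 * m) := by gcongr
    _ = 2000 / 729 * m ^ 2 * m := by ring
    _ ≤ 2000 / 729 * m ^ 2 * 1 := by gcongr
    _ ≤ 3 * m ^ 2 := by nlinarith [sq_nonneg m]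

/-- The formulas `1 / (b - x)` extend the system conformally to `(-1/10, 11/10)`. -/
theorem isConformalExtension_bcf :
    IsConformalExtension (Set.Icc (0 : ℝ) 1) bcf (Set.Ioo (-(1 / 10)) (11 / 10)) bcf where
  isOpen := isOpen_Ioo
  isConnected := isConnected_Ioo (by norm_num)
  subset := Set.Icc_subset_Ioo (by norm_num) (by norm_num)
  eqOn i := fun _ _ => rfl
  conformal b := by
    rw [← wordMap_singleton]
    refine isConformalOn_wordMap _ fun x hx => ?_
    rw [denom_singleton]
    linarith [two_le_digit b, hx.2]
  word_conformal w hw := by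
    refine ⟨isConformalOn_wordMap _ fun x hx => ?_, ?_⟩
    · linarith [le_denom_of_admissible hw hx]
    · exact (wordMap_mapsTo_of_admissible hw).mono_right
        (Set.Icc_subset_Ioo (by norm_num) (by norm_num))
  bounded_distortion := by
    refine ⟨16, by norm_num, fun w hw x hx y hy => ?_⟩
    have hx0 : 0 < denom w x := by linarith [le_denom_of_admissible hw hx]
    have hy0 : 0 < denom w y := by linarith [le_denom_of_admissible hw hy]
    rw [norm_fderiv_wordMap w hx0, norm_fderiv_wordMap w hy0, mul_one_div,
      div_le_div_iff₀ (by positivity) (by positivity), one_mul]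
    calc denom w x ^ 2 ≤ (4 * denom w y) ^ 2 :=
          pow_le_pow_left₀ hx0.le (denom_le_of_admissible hw hx hy) 2
      _ = 16 * denom w y ^ 2 := by ring
  contraction := by
    refine ⟨1 / (6 / 5) ^ 2, by norm_num, fun w hw x hx => ?_⟩
    have h := le_denom_of_admissible hw hx
    rw [norm_fderiv_wordMap w (by linarith)]
    exact one_div_le_one_div_of_le (by norm_num) (pow_le_pow_left₀ (by norm_num) h 2)
  holder := by
    refine ⟨3, 1, by norm_num, one_pos, fun b x hx y hy => ?_⟩
    have hb := two_le_digit b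
    have h : ∀ z ∈ Set.Ioo (-(1 / 10) : ℝ) (11 / 10),
        ‖fderiv ℝ (bcf b) z‖ = 1 / ((b.1 : ℝ) - z) ^ 2 := fun z hz => by
      rw [← wordMap_singleton b, norm_fderiv_wordMap, denom_singleton]
      rw [denom_singleton]
      linarith [hz.2]
    have hd : (derivNorm (Set.Icc (0 : ℝ) 1) (bcf b)).toReal = 1 / ((b.1 : ℝ) - 1) ^ 2 := by
      rw [← wordMap_singleton b, derivNorm_wordMap, ENNReal.toReal_ofReal (by positivity),
        denom_singleton]
    rw [h x hx, h y hy, hd, Real.rpow_one, Real.dist_eq]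
    exact holder_bcf b hx hy

/-! ### The conditions on `[0, 1]` -/

theorem bcf_image_Ioo_subset (b : Digit) :
    bcf b '' Set.Ioo 0 1 ⊆ Set.Ioo (1 / (b.1 : ℝ)) (1 / (b.1 - 1)) := by
  have hb := two_le_digit b
  rintro _ ⟨x, hx, rfl⟩
  exact ⟨one_div_lt_one_div_of_lt (by linarith [hx.2]) (by linarith [hx.1]),
    one_div_lt_one_div_of_lt (by linarith) (by linarith [hx.2])⟩

theorem disjoint_bcf_image {i j : Digit} (hij : i.1 < j.1) :
    Disjoint (bcf i '' Set.Ioo 0 1) (bcf j '' Set.Ioo 0 1) := by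
  refine Set.disjoint_left.2 fun x hi hj => ?_
  have h1 := (bcf_image_Ioo_subset i hi).1
  have h2 := (bcf_image_Ioo_subset j hj).2
  have h3 : (i.1 : ℝ) + 1 ≤ j.1 := by exact_mod_cast hij
  have h4 : 1 / ((j.1 : ℝ) - 1) ≤ 1 / i.1 :=
    one_div_le_one_div_of_le (by linarith [two_le_digit i]) (by linarith)
  linarith

theorem bcf_two_iterate_eq (n : ℕ) : (bcf two)^[n] = wordMap bcf (List.replicate n two) := by
  induction n with
  | zero => rfl
  | succ n ih => rw [Function.iterate_succ', ih, List.replicate_succ, wordMap]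

theorem wordMap_image_subset (w : List Digit) :
    wordMap bcf w '' Set.Icc 0 1 ⊆ Set.Icc (wordMap bcf w 0) (wordMap bcf w 1) := by
  rintro _ ⟨x, hx, rfl⟩
  have h0 : (0 : ℝ) ∈ Set.Iic (1 : ℝ) := Set.mem_Iic.2 zero_le_one
  exact ⟨wordMap_monotoneOn w h0 hx.2 hx.1, wordMap_monotoneOn w hx.2 (le_refl (1 : ℝ)) hx.2⟩

theorem dist_le_of_mem_wordMap_image {w : List Digit} {x y : ℝ}
    (hx : x ∈ wordMap bcf w '' Set.Icc 0 1) (hy : y ∈ wordMap bcf w '' Set.Icc 0 1) :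
    dist x y ≤ 1 / (w.length + 1) := by
  refine (Real.dist_le_of_mem_Icc (wordMap_image_subset w hx) (wordMap_image_subset w hy)).trans ?_
  rw [← cylLength_eq]
  exact cylLength_le w

theorem diam_wordMap_image_le (w : List Digit) :
    Metric.diam (wordMap bcf w '' Set.Icc 0 1) ≤ 1 / (w.length + 1) :=
  Metric.diam_le_of_forall_dist_le (by positivity) fun _ hx _ hy =>
    dist_le_of_mem_wordMap_image hx hy

/-- A point common to cylinders of all lengths is their only common point. -/
theorem iInter_wordMap_image_eq {w : ℕ → List Digit} (hw : ∀ n, (w n).length = n) {x : ℝ}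
    (hx : ∀ n, x ∈ wordMap bcf (w n) '' Set.Icc 0 1) :
    ⋂ n, wordMap bcf (w n) '' Set.Icc 0 1 = {x} := by
  refine Set.eq_singleton_iff_unique_mem.2 ⟨Set.mem_iInter.2 hx, fun y hy => ?_⟩
  refine dist_le_zero.1 (ge_of_tendsto' tendsto_one_div_add_atTop_nhds_zero_nat fun n => ?_)
  have := dist_le_of_mem_wordMap_image (Set.mem_iInter.1 hy n) (hx n)
  rwa [hw] at this

theorem exists_openCone_subset_interior_Icc (x : ℝ) (hx : x ∈ frontier (Set.Icc (0 : ℝ) 1)) :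
    ∃ u : ℝ, ‖u‖ = 1 ∧ openCone x u (Real.pi / 3) 1 ⊆ interior (Set.Icc (0 : ℝ) 1) := by
  rw [frontier_Icc zero_le_one] at hx
  rw [interior_Icc]
  rcases hx with rfl | rfl
  · refine ⟨1, by simp, fun y hy => ?_⟩
    obtain ⟨h1, h2⟩ := hy
    simp only [Real.inner_apply] at h1 h2
    rw [Real.cos_pi_div_three] at h1
    exact ⟨by linarith [norm_nonneg (y - 0)], by linarith⟩
  · refine ⟨-1, by simp, fun y hy => ?_⟩
    obtain ⟨h1, h2⟩ := hy
    simp only [Real.inner_apply] at h1 h2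
    rw [Real.cos_pi_div_three] at h1
    exact ⟨by linarith, by linarith [norm_nonneg (y - 1)]⟩

theorem isParabolicIFS_bcf : IsParabolicIFS (Set.Icc (0 : ℝ) 1) bcf where
  countable := inferInstance
  nontrivial := ⟨⟨2, le_refl 2⟩, ⟨3, by norm_num⟩, by simp⟩
  isCompact := isCompact_Icc
  isConnected := isConnected_Icc zero_le_one
  mapsTo := bcf_mapsTo
  open_set_condition i j hij := by
    rw [interior_Icc]
    rcases lt_or_gt_of_ne (fun h => hij (Subtype.ext h) : i.1 ≠ j.1) with h | h
    · exact disjoint_bcf_image h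
    · exact (disjoint_bcf_image h).symm
  finite_parabolic := by
    refine (Set.finite_singleton ((two, 1) : Digit × ℝ)).subset fun p hp => ?_
    obtain ⟨h1, h2⟩ := (isParabolicPair_iff p.1 p.2).1 hp
    exact Prod.ext (Subtype.ext h1) h2
  deriv_lt_one b x hx h := by
    have hb := two_le_digit b
    rw [← wordMap_singleton b, norm_fderivWithin_wordMap _ hx, denom_singleton]
    have h1 : 1 < (b.1 : ℝ) - x := by
      by_contra! h2
      refine h ((isParabolicPair_iff b x).2 ⟨?_, by linarith [hx.2]⟩)
      exact_mod_cast (by linarith [hx.2] : (b.1 : ℝ) = 2)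
    rw [div_lt_one (by positivity)]
    exact one_lt_pow₀ h1 two_ne_zero
  extension := ⟨_, _, isConformalExtension_bcf⟩
  parabolic_iterates b x h := by
    obtain ⟨h1, rfl⟩ := (isParabolicPair_iff b x).1 h
    obtain rfl : b = two := Subtype.ext h1
    simp only [bcf_two_iterate_eq]
    refine ⟨iInter_wordMap_image_eq (fun n => List.length_replicate) fun n =>
      ⟨1, Set.right_mem_Icc.2 zero_le_one, wordMap_replicate_two_one n⟩, ?_⟩
    refine squeeze_zero (fun n => Metric.diam_nonneg) (fun n => ?_)
      tendsto_one_div_add_atTop_nhds_zero_nat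
    simpa using diam_wordMap_image_le (List.replicate n two)
  cone_condition := ⟨Real.pi / 3, 1, by positivity, by linarith [Real.pi_pos], one_pos,
    exists_openCone_subset_interior_Icc⟩
  parabolic := ⟨two, 1, (isParabolicPair_iff _ _).2 ⟨rfl, rfl⟩⟩

/-! ### The limit set -/

/-- One step of the expansion algorithm: `x = 1 / (b - y)` with `b = ⌈1 / x⌉`. -/
theorem exists_bcf_eq (x : {x : ℝ // Irrational x ∧ x ∈ Set.Ioo (0 : ℝ) 1}) :
    ∃ (b : Digit) (y : {x : ℝ // Irrational x ∧ x ∈ Set.Ioo (0 : ℝ) 1}), bcf b y.1 = x.1 := by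
  obtain ⟨x, hirr, h0, h1⟩ := x
  have hinv : 1 < 1 / x := (one_lt_div h0).2 h1
  have hle := Nat.le_ceil (1 / x)
  have hlt := Nat.ceil_lt_add_one (zero_le_one.trans hinv.le)
  have h2 : 2 ≤ ⌈1 / x⌉₊ := by
    have : (1 : ℝ) < ⌈1 / x⌉₊ := hinv.trans_le hle
    exact_mod_cast this
  have hirr' : Irrational ((⌈1 / x⌉₊ : ℝ) - 1 / x) := by
    rw [one_div]
    exact hirr.inv.natCast_sub _
  refine ⟨⟨_, h2⟩, ⟨_, hirr', ?_, by linarith⟩, ?_⟩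
  · exact lt_of_le_of_ne (sub_nonneg.2 hle) fun h => hirr'.ne_zero h.symm
  · simp [bcf]

/-- Every irrational number in `(0, 1)` has a backward continued fraction expansion. -/
theorem irrational_mem_limitSet {x : ℝ} (hx : Irrational x) (h01 : x ∈ Set.Ioo (0 : ℝ) 1) :
    x ∈ limitSet (Set.Icc (0 : ℝ) 1) bcf := by
  choose digit next hnext using exists_bcf_eq
  let orbit : ℕ → {x : ℝ // Irrational x ∧ x ∈ Set.Ioo (0 : ℝ) 1} := fun n => next^[n] ⟨x, hx, h01⟩
  have h : ∀ n : ℕ,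
      wordMap bcf (List.ofFn fun k : Fin n => digit (orbit k)) (orbit n).1 = x := fun n => by
    induction n with
    | zero => rfl
    | succ n ih =>
      rw [List.ofFn_succ', List.concat_eq_append, wordMap_snoc_apply]
      simp only [Fin.val_castSucc, Fin.val_last]
      rw [show orbit (n + 1) = next (orbit n) from Function.iterate_succ_apply' _ _ _, hnext, ih]
  exact ⟨fun n => digit (orbit n), iInter_wordMap_image_eq (fun n => List.length_ofFn) fun n =>
    ⟨_, Set.Ioo_subset_Icc_self (orbit n).2.2, h n⟩⟩

open MeasureTheory in
theorem dimH_limitSet_bcf : dimH (limitSet (Set.Icc (0 : ℝ) 1) bcf) = 1 := by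
  refine le_antisymm ((dimH_mono (Set.subset_univ _)).trans Real.dimH_univ.le) ?_
  have hsub : Set.Ioo (0 : ℝ) 1 ⊆
      limitSet (Set.Icc (0 : ℝ) 1) bcf ∪ Set.range ((↑) : ℚ → ℝ) := fun x hx => by
    by_cases hirr : Irrational x
    · exact Or.inl (irrational_mem_limitSet hirr hx)
    · exact Or.inr (not_not.1 hirr)
  have hpos : μH[((1 : NNReal) : ℝ)] (limitSet (Set.Icc (0 : ℝ) 1) bcf) ≠ 0 := fun h => by
    rw [NNReal.coe_one, hausdorffMeasure_real] at h
    have h1 := measure_mono (μ := volume) hsub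
    rw [measure_union_null h ((Set.countable_range _).measure_zero _), Real.volume_Ioo] at h1
    simp at h1
  simpa using le_dimH_of_hausdorffMeasure_ne_zero hpos

theorem proposition4p1 :
    IsParabolicIFS (Set.Icc (0 : ℝ) 1) bcf ∧
    IsRegularParabolic (Set.Icc (0 : ℝ) 1) bcf ∧
    parabolicIndices (Set.Icc (0 : ℝ) 1) bcf = {⟨2, le_refl 2⟩} ∧
    (∀ (b : {b : ℕ // 2 ≤ b}) (x : ℝ),
      IsParabolicPair (Set.Icc (0 : ℝ) 1) bcf b x ↔ b.1 = 2 ∧ x = 1) ∧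
    dimH (limitSet (Set.Icc (0 : ℝ) 1) bcf) = 1 :=
  ⟨isParabolicIFS_bcf, isRegularParabolic_bcf, parabolicIndices_bcf, isParabolicPair_iff,
    dimH_limitSet_bcf⟩
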